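/- Let $d\ge 2$ and let $\mu=(\mu_1\ge\dots\ge\mu_d\ge 0)$ be a partition of $n$ with $\mu_2>0$. Write $\binom{n}{\mu}=\frac{n!}{\mu_1!\cdots\mu_d!}$. On $(\mathbb{C}^d)^{\otimes n}$ define $$\rho_=^n=\int U^{\otimes n}|1^n\rangle\langle 1^n|(U^\dagger)^{\otimes n}\,dU,\qquad \rho_{\neq}^{\mu}=\int U^{\otimes n}|1^{\mu_1}2^{\mu_2}\cdots d^{\mu_d}\rangle\langle 1^{\mu_1}2^{\mu_2}\cdots d^{\mu_d}|(U^\dagger)^{\otimes n}\,dU,$$ where $dU$ is the normalized Haar measure on the unitary group $\mathbb{U}(d)$ and $|i^{k}\rangle=|i\rangle^{\otimes k}$ for the standard basis vectors $|1\rangle,\dots,|d\rangle$ of $\mathbb{C}^d$. For a two-outcome POVM $\{\Pi_=,\Pi_{\neq}=\mathbb{1}-\Pi_=\}$, $0\preceq\Pi_=\preceq\mathbb{1}$, let $\mathbb{P}_c=\mathrm{Tr}[\Pi_=\rho_=^n]$ and $\mathbb{P}_s=\mathrm{Tr}[\Pi_{\neq}\rho_{\neq}^\mu]$ be its completeness and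 soundness, and $\alpha=1-\mathbb{P}_c$ and $\beta=1-\mathbb{P}_s$ its type I and type II errors. Let $\mathcal{R}(\mu)$ be the set of all pairs $(\alpha,\beta)$ achieved by such POVMs. Then $$\mathcal{R}(\mu)=\Big\{(\alpha,\beta)\in[0,1]^2 \;\Big|\; \frac{1-\alpha}{\binom{n}{\mu}}\le\beta\le 1-\frac{\alpha}{\binom{n}{\mu}}\Big\}.$$ In particular, for every $\alpha\in[0,1]$ the least and the greatest $\beta$ with $(\alpha,\beta)\in\mathcal{R}(\mu)$ are $\beta=\frac{1-\alpha}{\binom{n}{\mu}}$ (the lower boundary, i.e. the optimal trade-off) and $\beta=1-\frac{\alpha}{\binom{n}{\mu}}$ (the upper boundary). Equivalently, for every $c\in[0,1]$ the largest soundness $\mathbb{P}_s$ of a POVM with completeness $\mathbb{P}_c=c$ is $1-c/\binom{n}{\mu}$. -/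

import Mathlib

open scoped Matrix ComplexOrder

noncomputable section

namespace QSI

/-- The unitary group `U(d)`, with the topology induced from complex `d × d` matrices. -/
abbrev UGroup (d : ℕ) : Type := Matrix.unitaryGroup (Fin d) ℂ

instance instMeasurableSpaceUGroup (d : ℕ) : MeasurableSpace (UGroup d) := borel (UGroup d)

instance instBorelSpaceUGroup (d : ℕ) : BorelSpace (UGroup d) := ⟨rfl⟩

instance instCompactSpaceUGroup (d : ℕ) : CompactSpace (UGroup d) := by
  apply isCompact_iff_compactSpace.mp
  have hK : IsCompact (X := Matrix (Fin d) (Fin d) ℂ) (Set.pi Set.univ fun _ : Fin d =>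
      Set.pi Set.univ fun _ : Fin d => Metric.closedBall (0 : ℂ) 1) :=
    isCompact_univ_pi fun _ => isCompact_univ_pi fun _ => isCompact_closedBall 0 1
  refine hK.of_isClosed_subset ?_ ?_
  · have h : (Matrix.unitaryGroup (Fin d) ℂ : Set (Matrix (Fin d) (Fin d) ℂ)) =
        {A | A * star A = 1} := by
      ext A
      exact Matrix.mem_unitaryGroup_iff
    rw [h]
    exact isClosed_eq (by fun_prop) continuous_const
  · intro A hA i _ j _
    simpa using entry_norm_bound_of_unitary hA i j

/-- The normalized Haar measure on `U(d)` (total mass `1`). -/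
def haar (d : ℕ) : MeasureTheory.Measure (UGroup d) :=
  MeasureTheory.Measure.haarMeasure ⊤

/-- Operators on `(ℂ^d)^{⊗ n}`, as matrices in the computational basis, which is indexed by the
words of length `n` over the alphabet `Fin d`. The letters
`1, …, d` are the elements `0, …, d - 1` of `Fin d`. -/
abbrev Op (n d : ℕ) : Type := Matrix (Fin n → Fin d) (Fin n → Fin d) ℂ

/-- The `n`-fold tensor (Kronecker) power `A^{⊗ n}`. -/
def tensorPow (n : ℕ) {d : ℕ} (A : Matrix (Fin d) (Fin d) ℂ) : Op n d :=
  Matrix.of fun x y => ∏ k, A (x k) (y k)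

/-- The projector `|w⟩⟨w|` onto the computational basis vector of the word `w`. -/
def ketBra {n d : ℕ} (w : Fin n → Fin d) : Op n d := Matrix.single w w 1

/-- The Haar twirl `∫ U^{⊗ n} X (U†)^{⊗ n} dU`; the integral of a matrix-valued function is taken
entry by entry (the integrand is continuous on a compact group). -/
def twirl {n d : ℕ} (X : Op n d) : Op n d :=
  Matrix.of fun x y =>
    ∫ U : UGroup d, (tensorPow n (U : Matrix (Fin d) (Fin d) ℂ) * X *
      tensorPow n (U : Matrix (Fin d) (Fin d) ℂ)ᴴ) x y ∂(haar d)

/-- The word `1^{μ₁} 2^{μ₂} ⋯ d^{μ_d}`: the first `μ₁` letters are the first letter, the next `μ₂`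
letters are the second one, and so on. -/
def blockWord {n d : ℕ} (μ : Fin d → ℕ) (hμ : ∑ i, μ i = n) (k : Fin n) : Fin d :=
  (finSigmaFinEquiv.symm (Fin.cast hμ.symm k)).1

/-- The state `ρ_=^n`: the Haar twirl of `|1^n⟩⟨1^n|`. -/
def rhoEq (n : ℕ) {d : ℕ} (hd : 0 < d) : Op n d := twirl (ketBra fun _ => ⟨0, hd⟩)

/-- The state `ρ_≠^μ`: the Haar twirl of the projector onto `|1^{μ₁} ⋯ d^{μ_d}⟩`. -/
def rhoNeq {n d : ℕ} (μ : Fin d → ℕ) (hμ : ∑ i, μ i = n) : Op n d :=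
  twirl (ketBra (blockWord μ hμ))

/-- `P` is the element `Π_=` of a two-outcome POVM `{Π_=, 1 - Π_=}`. -/
def IsTest {n d : ℕ} (P : Op n d) : Prop := P.PosSemidef ∧ (1 - P).PosSemidef

/-- The completeness `Tr[Π_= ρ₀]` of the test `P = Π_=` for the null hypothesis `ρ₀`. (The trace
of a product of two Hermitian matrices is real.) -/
def completeness {n d : ℕ} (ρ₀ P : Op n d) : ℝ := (P * ρ₀).trace.re

/-- The soundness `Tr[Π_≠ ρ₁]`, `Π_≠ = 1 - Π_=`, of the test `P = Π_=` for the alternative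
hypothesis `ρ₁`. -/
def soundness {n d : ℕ} (ρ₁ P : Op n d) : ℝ := ((1 - P) * ρ₁).trace.re

/-- The type I error `α = 1 - P_c`. -/
def typeI {n d : ℕ} (ρ₀ P : Op n d) : ℝ := 1 - completeness ρ₀ P

/-- The type II error `β = 1 - P_s`. -/
def typeII {n d : ℕ} (ρ₁ P : Op n d) : ℝ := 1 - soundness ρ₁ P

/-- The hypothesis testing region: all achievable pairs `(α, β)` of type I and type II errors. -/
def region {n d : ℕ} (ρ₀ ρ₁ : Op n d) : Set (ℝ × ℝ) :=
  {e | ∃ P : Op n d, IsTest P ∧ typeI ρ₀ P = e.1 ∧ typeII ρ₁ P = e.2}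

end QSI

end

/-!
The commutant of the representation `U ↦ U^{⊗ n}` acts by scalars on the symmetric subspace, with
orthogonal projector `S = symProj n d` (`commutant_mul_symProj`). This is all of Schur-Weyl theory
that is needed, and it is proved by hand: diagonal unitaries show that the entries of an operator
in the commutant vanish between words of different content, and one unitary without zero entries,
applied to `|1^n⟩`, compares the scalars on the different contents.

Both twirled states lie in the commutant. The state `ρ_=^n` is supported on the symmetric subspace,
so it is `S / Tr S`. The state `ρ_≠^μ` commutes with `S`, and its symmetric part is a multiple of
`ρ_=^n`, of weight `⟨w|S|w⟩` with `w = 1^{μ₁} ⋯ d^{μ_d}`; this is the proportion of permutations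
fixing `w`, that is `1 / M` with `M` the multinomial coefficient (`rhoNeq_mul_symProj`). Hence
`ρ_≠^μ = ρ_=^n / M + R` with `R ≥ 0` supported on the orthogonal complement of the symmetric
subspace and `Tr R = 1 - 1 / M`. For a test `P` this gives `β = (1 - α) / M + Tr(P R)` with
`0 ≤ Tr(P R) ≤ 1 - 1 / M`, and the tests `(1 - α) S + t (1 - S)`, `t ∈ [0, 1]`, realize all these
values (`mem_region_iff`).
-/

open Matrix MeasureTheory

namespace QSI

/-! ### Tensor powers -/

lemma tensorPow_mul (n : ℕ) {d : ℕ} (A B : Matrix (Fin d) (Fin d) ℂ) :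
    tensorPow n (A * B) = tensorPow n A * tensorPow n B := by
  ext x y
  simp only [tensorPow, Matrix.of_apply, Matrix.mul_apply, Finset.prod_univ_sum,
    Finset.prod_mul_distrib, Fintype.piFinset_univ]

lemma tensorPow_one (n d : ℕ) : tensorPow n (1 : Matrix (Fin d) (Fin d) ℂ) = 1 := by
  ext x y
  simp only [tensorPow, Matrix.of_apply, Matrix.one_apply, Finset.prod_ite_zero,
    Finset.prod_const_one, Finset.mem_univ, true_imp_iff, funext_iff]

lemma tensorPow_conjTranspose (n : ℕ) {d : ℕ} (A : Matrix (Fin d) (Fin d) ℂ) :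
    tensorPow n Aᴴ = (tensorPow n A)ᴴ := by
  ext x y
  simp [tensorPow, Matrix.conjTranspose_apply]

lemma tensorPow_conjTranspose_mul_self (n : ℕ) {d : ℕ} (U : UGroup d) :
    tensorPow n (U : Matrix (Fin d) (Fin d) ℂ)ᴴ * tensorPow n (U : Matrix (Fin d) (Fin d) ℂ) =
      1 := by
  rw [← tensorPow_mul, ← Matrix.star_eq_conjTranspose, Matrix.mem_unitaryGroup_iff'.1 U.2,
    tensorPow_one]

/-! ### The Haar twirl -/

/-- The conjugation `U^{⊗ n} X (U†)^{⊗ n}`, the integrand of the twirl. -/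
def conjTensor {n d : ℕ} (X : Op n d) (U : UGroup d) : Op n d :=
  tensorPow n (U : Matrix (Fin d) (Fin d) ℂ) * X * tensorPow n (U : Matrix (Fin d) (Fin d) ℂ)ᴴ

instance isProbabilityMeasure_haar (d : ℕ) : IsProbabilityMeasure (haar d) :=
  ⟨Measure.haarMeasure_self⟩

instance isMulLeftInvariant_haar (d : ℕ) : (haar d).IsMulLeftInvariant := by
  unfold haar
  infer_instance

lemma continuous_tensorPow (n d : ℕ) :
    Continuous fun A : Matrix (Fin d) (Fin d) ℂ => tensorPow n A := by
  refine continuous_matrix fun x y => ?_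
  simp only [tensorPow, Matrix.of_apply]
  fun_prop

lemma continuous_conjTensor {n d : ℕ} (X : Op n d) : Continuous (conjTensor X) := by
  have h := continuous_tensorPow n d
  unfold conjTensor
  fun_prop

lemma integrable_of_continuous_haar {d : ℕ} {f : UGroup d → ℂ} (hf : Continuous f) :
    Integrable f (haar d) :=
  hf.integrable_of_hasCompactSupport (HasCompactSupport.of_compactSpace f)

lemma twirl_apply {n d : ℕ} (X : Op n d) (x y : Fin n → Fin d) :
    twirl X x y = ∫ U, conjTensor X U x y ∂(haar d) := rfl

lemma mul_twirl_mul_apply {n d : ℕ} (A X B : Op n d) (x y : Fin n → Fin d) :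
    (A * twirl X * B) x y = ∫ U, (A * conjTensor X U * B) x y ∂(haar d) := by
  have hc : ∀ i j, Continuous fun U : UGroup d => conjTensor X U i j :=
    fun i j => (continuous_conjTensor X).matrix_elem i j
  simp only [Matrix.mul_apply, twirl_apply, Finset.sum_mul]
  rw [integral_finsetSum _ fun j _ => integrable_of_continuous_haar (by fun_prop)]
  refine Finset.sum_congr rfl fun j _ => ?_
  rw [integral_finsetSum _ fun i _ => integrable_of_continuous_haar (by fun_prop)]
  refine Finset.sum_congr rfl fun i _ => ?_
  rw [integral_mul_const, integral_const_mul]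

lemma trace_mul_twirl {n d : ℕ} (A X : Op n d) :
    (A * twirl X).trace = ∫ U, (A * conjTensor X U).trace ∂(haar d) := by
  have hc := continuous_conjTensor X
  simp only [Matrix.trace, Matrix.diag_apply]
  rw [integral_finsetSum _ fun j _ => integrable_of_continuous_haar
    ((continuous_const.matrix_mul hc).matrix_elem j j)]
  refine Finset.sum_congr rfl fun j _ => ?_
  simpa using mul_twirl_mul_apply A X 1 j j

lemma trace_mul_twirl_of_commute {n d : ℕ} {A : Op n d} (X : Op n d)
    (hA : ∀ U : UGroup d, Commute A (tensorPow n (U : Matrix (Fin d) (Fin d) ℂ))) :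
    (A * twirl X).trace = (A * X).trace := by
  have h : ∀ U, (A * conjTensor X U).trace = (A * X).trace := fun U => by
    rw [conjTensor, ← mul_assoc, ← mul_assoc, (hA U).eq, Matrix.trace_mul_comm, ← mul_assoc,
      ← mul_assoc, tensorPow_conjTranspose_mul_self, one_mul]
  simp [trace_mul_twirl, h]

lemma trace_twirl {n d : ℕ} (X : Op n d) : (twirl X).trace = X.trace := by
  simpa using trace_mul_twirl_of_commute X fun U => Commute.one_left _

lemma twirl_mul_of_commute {n d : ℕ} {A : Op n d} (X : Op n d)
    (hA : ∀ B : Matrix (Fin d) (Fin d) ℂ, Commute A (tensorPow n B)) :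
    twirl X * A = twirl (X * A) := by
  ext x y
  have := mul_twirl_mul_apply 1 X A x y
  rw [one_mul] at this
  rw [this, twirl_apply]
  simp only [conjTensor, one_mul, mul_assoc, (hA _).eq]

/-- Twirled operators lie in the commutant of the tensor power representation, by left invariance
of the Haar measure. -/
lemma commute_twirl {n d : ℕ} (X : Op n d) (V : UGroup d) :
    Commute (twirl X) (tensorPow n (V : Matrix (Fin d) (Fin d) ℂ)) := by
  have h : tensorPow n (V : Matrix (Fin d) (Fin d) ℂ) * twirl X *
      tensorPow n (V : Matrix (Fin d) (Fin d) ℂ)ᴴ = twirl X := by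
    ext x y
    rw [mul_twirl_mul_apply, twirl_apply,
      ← integral_mul_left_eq_self (fun U => conjTensor X U x y) V]
    simp only [conjTensor, Submonoid.coe_mul, Matrix.conjTranspose_mul, tensorPow_mul, mul_assoc]
  rw [commute_iff_eq]
  nth_rw 1 [← h]
  rw [mul_assoc, tensorPow_conjTranspose_mul_self, mul_one]

lemma _root_.Matrix.PosSemidef.trace_mul_nonneg {m : Type*} [Fintype m] {A B : Matrix m m ℂ}
    (hA : A.PosSemidef) (hB : B.PosSemidef) : 0 ≤ (A * B).trace := by
  obtain ⟨k, v, rfl⟩ := Matrix.posSemidef_iff_eq_sum_vecMulVec.1 hB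
  rw [Matrix.mul_sum, Matrix.trace_sum]
  refine Finset.sum_nonneg fun i _ => ?_
  rw [Matrix.mul_vecMulVec, Matrix.trace_vecMulVec, dotProduct_comm]
  exact hA.dotProduct_mulVec_nonneg _

lemma posSemidef_conjTensor {n d : ℕ} {X : Op n d} (hX : X.PosSemidef) (U : UGroup d) :
    (conjTensor X U).PosSemidef := by
  rw [conjTensor, tensorPow_conjTranspose]
  exact hX.mul_mul_conjTranspose_same _

lemma posSemidef_twirl {n d : ℕ} {X : Op n d} (hX : X.PosSemidef) : (twirl X).PosSemidef := by
  refine .of_dotProduct_mulVec_nonneg ?_ fun v => ?_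
  · ext x y
    rw [Matrix.conjTranspose_apply, twirl_apply, twirl_apply]
    refine (integral_conj (f := fun U => conjTensor X U y x)).symm.trans ?_
    exact integral_congr_ae (.of_forall fun U => (posSemidef_conjTensor hX U).1.apply x y)
  · have h : star v ⬝ᵥ twirl X *ᵥ v = (Matrix.vecMulVec v (star v) * twirl X).trace := by
      rw [Matrix.trace_mul_comm, Matrix.mul_vecMulVec, Matrix.trace_vecMulVec, dotProduct_comm]
    rw [h, trace_mul_twirl]
    exact integral_nonneg fun U =>
      (Matrix.posSemidef_vecMulVec_self_star v).trace_mul_nonneg (posSemidef_conjTensor hX U)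

/-! ### The symmetrizer -/

/-- The operator permuting the `n` tensor factors by `σ`. -/
def permOp (n d : ℕ) (σ : Equiv.Perm (Fin n)) : Op n d :=
  Matrix.of fun x y => if x ∘ σ = y then 1 else 0

/-- The orthogonal projector onto the symmetric subspace of `(ℂ^d)^{⊗ n}`, as the average of the
permutation operators. -/
noncomputable def symProj (n d : ℕ) : Op n d := (n.factorial : ℂ)⁻¹ • ∑ σ, permOp n d σ

lemma permOp_mul_apply {n d : ℕ} (σ : Equiv.Perm (Fin n)) (A : Op n d) (x y : Fin n → Fin d) :
    (permOp n d σ * A) x y = A (x ∘ σ) y := by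
  simp [permOp, Matrix.mul_apply]

lemma permOp_mul_permOp {n d : ℕ} (σ τ : Equiv.Perm (Fin n)) :
    permOp n d σ * permOp n d τ = permOp n d (σ * τ) := by
  ext x y
  rw [permOp_mul_apply]
  rfl

lemma comp_perm_eq_iff {n d : ℕ} (σ : Equiv.Perm (Fin n)) (x y : Fin n → Fin d) :
    x ∘ σ = y ↔ y ∘ (σ⁻¹ : Equiv.Perm (Fin n)) = x := by
  constructor <;> rintro rfl <;> ext k <;> simp

lemma permOp_conjTranspose {n d : ℕ} (σ : Equiv.Perm (Fin n)) :
    (permOp n d σ)ᴴ = permOp n d σ⁻¹ := by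
  ext x y
  simp only [permOp, Matrix.conjTranspose_apply, Matrix.of_apply, comp_perm_eq_iff σ y x]
  split_ifs <;> simp

lemma permOp_mul_symProj {n d : ℕ} (σ : Equiv.Perm (Fin n)) :
    permOp n d σ * symProj n d = symProj n d := by
  simp only [symProj, Matrix.mul_smul, Matrix.mul_sum, permOp_mul_permOp]
  exact congrArg _ (Equiv.sum_comp (Equiv.mulLeft σ) fun τ => permOp n d τ)

lemma symProj_comp_perm {n d : ℕ} (σ : Equiv.Perm (Fin n)) (x y : Fin n → Fin d) :
    symProj n d (x ∘ σ) y = symProj n d x y := by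
  rw [← permOp_mul_apply σ (symProj n d), permOp_mul_symProj]

lemma symProj_mul_self (n d : ℕ) : symProj n d * symProj n d = symProj n d := by
  nth_rw 1 [symProj]
  rw [Matrix.smul_mul, Matrix.sum_mul]
  simp only [permOp_mul_symProj, Finset.sum_const, Finset.card_univ, Fintype.card_perm,
    Fintype.card_fin]
  rw [← Nat.cast_smul_eq_nsmul ℂ, inv_smul_smul₀ (by exact_mod_cast n.factorial_ne_zero)]

lemma symProj_isHermitian (n d : ℕ) : (symProj n d).IsHermitian := by
  rw [Matrix.IsHermitian, symProj, Matrix.conjTranspose_smul, Matrix.conjTranspose_sum]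
  simp only [permOp_conjTranspose]
  rw [star_inv₀, star_natCast]
  exact congrArg _ (Equiv.sum_comp (Equiv.inv _) fun τ => permOp n d τ)

lemma commute_symProj_tensorPow {n d : ℕ} (B : Matrix (Fin d) (Fin d) ℂ) :
    Commute (symProj n d) (tensorPow n B) := by
  refine Commute.smul_left (Commute.sum_left _ _ _ fun σ _ => ?_) _
  ext x y
  rw [permOp_mul_apply]
  simp only [permOp, Matrix.mul_apply, Matrix.of_apply, mul_ite, mul_one, mul_zero,
    comp_perm_eq_iff σ]
  simp only [tensorPow, Matrix.of_apply, Finset.sum_ite_eq, Finset.mem_univ, if_true]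
  rw [← Equiv.prod_comp σ fun k => B (x k) ((y ∘ ⇑(σ⁻¹ : Equiv.Perm (Fin n))) k)]
  simp

/-- The diagonal entry of the symmetrizer at a word is the proportion of permutations fixing it. -/
lemma symProj_apply_self {n d : ℕ} (w : Fin n → Fin d) :
    symProj n d w w =
      (n.factorial : ℂ)⁻¹ * ∏ i, ((Fintype.card {k // w k = i}).factorial : ℂ) := by
  simp only [symProj, Matrix.smul_apply, Matrix.sum_apply, smul_eq_mul, permOp, Matrix.of_apply,
    Finset.sum_boole]
  rw [← Fintype.card_subtype, DomMulAct.stabilizer_card]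
  push_cast
  rfl

/-! ### The commutant on the symmetric subspace -/

lemma exists_perm_of_card_fiber_eq {n d : ℕ} {x z : Fin n → Fin d}
    (h : ∀ a, Fintype.card {k // x k = a} = Fintype.card {k // z k = a}) :
    ∃ σ : Equiv.Perm (Fin n), z ∘ σ = x := by
  let e : ∀ a, {k // x k = a} ≃ {k // z k = a} := fun a => Fintype.equivOfCardEq (h a)
  exact ⟨Equiv.ofFiberEquiv e, funext fun k => Equiv.ofFiberEquiv_map e k⟩

/-- The diagonal unitary with entry `exp (iθ)` at the letter `a` and `1` elsewhere. -/
noncomputable def phaseUnitary {d : ℕ} (a : Fin d) (θ : ℝ) : UGroup d :=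
  ⟨Matrix.diagonal fun b => if b = a then Complex.exp (θ * Complex.I) else 1, by
    rw [Matrix.mem_unitaryGroup_iff, Matrix.star_eq_conjTranspose,
      Matrix.diagonal_conjTranspose, Matrix.diagonal_mul_diagonal, ← Matrix.diagonal_one]
    congr 1
    ext b
    by_cases hb : b = a
    · simp [hb, Complex.mul_conj, Complex.normSq_eq_norm_sq, Complex.norm_exp_ofReal_mul_I]
    · simp [hb]⟩

lemma tensorPow_phaseUnitary (n : ℕ) {d : ℕ} (a : Fin d) (θ : ℝ) :
    tensorPow n (phaseUnitary a θ : Matrix (Fin d) (Fin d) ℂ) =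
      Matrix.diagonal fun x =>
        Complex.exp (θ * Complex.I) ^ Fintype.card {k : Fin n // x k = a} := by
  ext x y
  simp only [tensorPow, phaseUnitary, Matrix.of_apply, Matrix.diagonal_apply,
    Finset.prod_ite_zero, Finset.mem_univ, true_imp_iff, funext_iff]
  refine if_congr Iff.rfl ?_ rfl
  rw [Finset.prod_ite, Finset.prod_const_one, mul_one, Finset.prod_const, Fintype.card_subtype]

/-- An operator commuting with all tensor powers of unitaries has no matrix entry between words
with different numbers of some letter: the diagonal unitaries separate them. -/
lemma exists_perm_of_commutant_apply_ne_zero {n d : ℕ} {T : Op n d}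
    (hT : ∀ U : UGroup d, Commute T (tensorPow n (U : Matrix (Fin d) (Fin d) ℂ)))
    {x z : Fin n → Fin d} (hxz : T x z ≠ 0) : ∃ σ : Equiv.Perm (Fin n), z ∘ σ = x := by
  refine exists_perm_of_card_fiber_eq fun a => ?_
  by_contra hne
  set p := Fintype.card {k // x k = a}
  set q := Fintype.card {k // z k = a}
  have hpq : (p : ℝ) - q ≠ 0 := sub_ne_zero.2 (by exact_mod_cast hne)
  -- with this angle, the `p`-th and the `q`-th power of the phase differ by a sign
  have h := congrFun (congrFun (hT (phaseUnitary a (Real.pi / (p - q)))).eq x) z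
  rw [tensorPow_phaseUnitary, Matrix.mul_diagonal, Matrix.diagonal_mul, mul_comm] at h
  have h' := mul_right_cancel₀ hxz h
  change _ ^ q = _ ^ p at h'
  rw [← Complex.exp_nat_mul, ← Complex.exp_nat_mul] at h'
  have hpq' : (p : ℂ) - q ≠ 0 := by exact_mod_cast hpq
  have hexp : (p : ℂ) * (((Real.pi / (p - q) : ℝ) : ℂ) * Complex.I) =
      q * (((Real.pi / (p - q) : ℝ) : ℂ) * Complex.I) + Real.pi * Complex.I := by
    push_cast
    field_simp
    ring
  rw [hexp, Complex.exp_add, Complex.exp_pi_mul_I, mul_neg_one] at h'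
  exact Complex.exp_ne_zero _ (self_eq_neg.1 h')

/-- The unitary `1 - ((1 - i) / d) J`, with `J` the all-ones matrix: a unitary without zero
entries. -/
noncomputable def fullUnitary (d : ℕ) (hd : 0 < d) : UGroup d :=
  ⟨1 - Matrix.of fun _ _ => (1 - Complex.I) / d, by
    have hd' : (d : ℂ) ≠ 0 := by exact_mod_cast hd.ne'
    rw [Matrix.mem_unitaryGroup_iff, Matrix.star_eq_conjTranspose, Matrix.conjTranspose_sub,
      Matrix.conjTranspose_one, mul_sub, mul_one, sub_mul, one_mul]
    ext i j
    simp only [Matrix.sub_apply, Matrix.mul_apply, Matrix.of_apply, Matrix.conjTranspose_apply,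
      Finset.sum_const, Finset.card_univ, Fintype.card_fin, nsmul_eq_mul, star_div₀, star_sub,
      star_one, Complex.star_def, Complex.conj_I, map_natCast]
    field_simp
    ring_nf
    simp⟩

lemma fullUnitary_apply_ne_zero {d : ℕ} (hd : 0 < d) (i j : Fin d) :
    (fullUnitary d hd : Matrix (Fin d) (Fin d) ℂ) i j ≠ 0 := by
  intro h
  have hd' : (d : ℝ) ≠ 0 := by exact_mod_cast hd.ne'
  have him := congrArg Complex.im h
  have : ((1 : Matrix (Fin d) (Fin d) ℂ) i j).im = 0 := by
    rw [Matrix.one_apply]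
    split_ifs <;> simp
  simp [fullUnitary, this, Complex.div_natCast_im, hd'] at him

/-- The irreducibility of the symmetric subspace, in the form of Schur's lemma: an operator `T`
commuting with all `U^{⊗ n}` is scalar on it. Indeed `T` fixes the line of `|1^n⟩`, hence that of
`U^{⊗ n}|1^n⟩`, a symmetric vector without zero entries for `U = fullUnitary`; since the entries of
`T` vanish between words of different content, this determines all row sums of `T`. -/
lemma commutant_mul_symProj {n d : ℕ} (hd : 0 < d) {T : Op n d}
    (hT : ∀ U : UGroup d, Commute T (tensorPow n (U : Matrix (Fin d) (Fin d) ℂ))) :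
    T * symProj n d = T (fun _ => ⟨0, hd⟩) (fun _ => ⟨0, hd⟩) • symProj n d := by
  set o : Fin n → Fin d := fun _ => ⟨0, hd⟩
  set A := tensorPow n (fullUnitary d hd : Matrix (Fin d) (Fin d) ℂ)
  have hAperm : ∀ (σ : Equiv.Perm (Fin n)) (z : Fin n → Fin d), A (z ∘ σ) o = A z o :=
    fun σ z => Equiv.prod_comp σ fun k =>
      (fullUnitary d hd : Matrix (Fin d) (Fin d) ℂ) (z k) ⟨0, hd⟩
  have hrow : ∀ x, ∑ z, T x z = T o o := by
    intro x
    have hA : A x o ≠ 0 := by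
      simp only [A, tensorPow, Matrix.of_apply]
      exact Finset.prod_ne_zero_iff.2 fun k _ => fullUnitary_apply_ne_zero hd _ _
    have h := congrFun (congrFun (hT (fullUnitary d hd)).eq x) o
    rw [Matrix.mul_apply, Matrix.mul_apply] at h
    have hl : ∑ z, T x z * A z o = (∑ z, T x z) * A x o := by
      rw [Finset.sum_mul]
      refine Finset.sum_congr rfl fun z _ => ?_
      by_cases hz : T x z = 0
      · simp [hz]
      · obtain ⟨σ, rfl⟩ := exists_perm_of_commutant_apply_ne_zero hT hz
        rw [hAperm]
    have hr : ∑ z, A x z * T z o = T o o * A x o := by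
      rw [mul_comm]
      refine Finset.sum_eq_single o (fun z _ hzo => ?_) (by simp)
      by_cases hz : T z o = 0
      · simp [hz]
      · obtain ⟨σ, rfl⟩ := exists_perm_of_commutant_apply_ne_zero hT hz
        exact absurd rfl hzo
    exact mul_right_cancel₀ hA (hl.symm.trans (h.trans hr))
  ext x y
  rw [Matrix.mul_apply, Matrix.smul_apply, smul_eq_mul, ← hrow x, Finset.sum_mul]
  refine Finset.sum_congr rfl fun z _ => ?_
  by_cases hz : T x z = 0
  · simp [hz]
  · obtain ⟨σ, rfl⟩ := exists_perm_of_commutant_apply_ne_zero hT hz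
    rw [symProj_comp_perm]

/-! ### The two states -/

lemma posSemidef_ketBra {n d : ℕ} (w : Fin n → Fin d) : (ketBra w).PosSemidef := by
  have h : ketBra w = Matrix.vecMulVec (Pi.single w 1) (star (Pi.single w 1)) := by
    ext x y
    simp [ketBra, Matrix.vecMulVec_apply, Matrix.single_apply, Pi.single_apply, eq_comm,
      ← ite_and, and_comm]
  rw [h]
  exact Matrix.posSemidef_vecMulVec_self_star _

lemma trace_ketBra {n d : ℕ} (w : Fin n → Fin d) : (ketBra w).trace = 1 := by
  simp [ketBra]

lemma ketBra_const_mul_symProj {n d : ℕ} (a : Fin d) :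
    ketBra (fun _ : Fin n => a) * symProj n d = ketBra fun _ => a := by
  have hp : ∀ σ, ketBra (fun _ : Fin n => a) * permOp n d σ = ketBra fun _ => a := fun σ => by
    ext x y
    by_cases hx : (fun _ => a) = x
    · subst hx
      simp [ketBra, permOp, Matrix.single_apply, Function.comp_def]
    · simp [ketBra, Matrix.mul_apply, hx]
  rw [symProj, Matrix.mul_smul, Matrix.mul_sum]
  simp only [hp, Finset.sum_const, Finset.card_univ, Fintype.card_perm, Fintype.card_fin]
  rw [← Nat.cast_smul_eq_nsmul ℂ, inv_smul_smul₀ (by exact_mod_cast n.factorial_ne_zero)]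

lemma card_blockWord_fiber {n d : ℕ} (μ : Fin d → ℕ) (hμ : ∑ i, μ i = n) (i : Fin d) :
    Fintype.card {k // blockWord μ hμ k = i} = μ i := by
  have e : {k // blockWord μ hμ k = i} ≃ {s : (j : Fin d) × Fin (μ j) // s.1 = i} :=
    ((finCongr hμ.symm).trans finSigmaFinEquiv.symm).subtypeEquiv fun k => Iff.rfl
  rw [Fintype.card_congr (e.trans (Equiv.sigmaSubtype i)), Fintype.card_fin]

lemma symProj_blockWord {n d : ℕ} (μ : Fin d → ℕ) (hμ : ∑ i, μ i = n) :
    symProj n d (blockWord μ hμ) (blockWord μ hμ) =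
      (Nat.multinomial Finset.univ μ : ℂ)⁻¹ := by
  have h := Nat.multinomial_spec Finset.univ μ
  have hM : (Nat.multinomial Finset.univ μ : ℂ) ≠ 0 := by
    exact_mod_cast (Nat.multinomial_pos Finset.univ μ).ne'
  have hn : (n.factorial : ℂ) ≠ 0 := by exact_mod_cast n.factorial_ne_zero
  rw [hμ] at h
  rw [symProj_apply_self]
  simp only [card_blockWord_fiber]
  rw [eq_comm, inv_eq_of_mul_eq_one_left]
  rw [mul_assoc, inv_mul_eq_one₀ hn, ← h]
  push_cast
  rfl

lemma commute_twirl_symProj {n d : ℕ} (hd : 0 < d) {X : Op n d} (hX : X.PosSemidef) :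
    Commute (twirl X) (symProj n d) := by
  have h := commutant_mul_symProj hd (commute_twirl X)
  have hρ := (posSemidef_twirl hX).1
  have h' := congrArg Matrix.conjTranspose h
  rw [Matrix.conjTranspose_mul, Matrix.conjTranspose_smul, (symProj_isHermitian n d).eq, hρ.eq,
    hρ.apply] at h'
  exact h.trans h'.symm

/-- The state `ρ_=^n` is the maximally mixed state on the symmetric subspace. -/
lemma rhoEq_eq_smul_symProj (n : ℕ) {d : ℕ} (hd : 0 < d) :
    ∃ c : ℂ, rhoEq n hd = c • symProj n d ∧ c * (symProj n d).trace = 1 := by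
  have h := commutant_mul_symProj hd (commute_twirl (ketBra fun _ : Fin n => (⟨0, hd⟩ : Fin d)))
  rw [twirl_mul_of_commute _ commute_symProj_tensorPow, ketBra_const_mul_symProj] at h
  refine ⟨_, h, ?_⟩
  rw [← smul_eq_mul, ← Matrix.trace_smul, ← h, trace_twirl, trace_ketBra]

/-- The symmetric part of `ρ_≠^μ` is `ρ_=^n`, with weight the inverse multinomial coefficient. -/
lemma rhoNeq_mul_symProj {n d : ℕ} (hd : 0 < d) (μ : Fin d → ℕ) (hμ : ∑ i, μ i = n) :
    rhoNeq μ hμ * symProj n d = (Nat.multinomial Finset.univ μ : ℂ)⁻¹ • rhoEq n hd := by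
  obtain ⟨c, hc, hct⟩ := rhoEq_eq_smul_symProj n hd
  have h := commutant_mul_symProj hd (commute_twirl (ketBra (blockWord μ hμ)))
  set e := twirl (ketBra (blockWord μ hμ)) (fun _ => ⟨0, hd⟩) (fun _ => ⟨0, hd⟩)
  have ht := congrArg Matrix.trace h
  rw [Matrix.trace_mul_comm, trace_mul_twirl_of_commute _ fun U => commute_symProj_tensorPow _,
    Matrix.trace_smul, smul_eq_mul] at ht
  have hs : (symProj n d * ketBra (blockWord μ hμ)).trace =
      (Nat.multinomial Finset.univ μ : ℂ)⁻¹ := by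
    rw [← symProj_blockWord μ hμ, ketBra, Matrix.trace_mul_single]
    simp
  rw [hs] at ht
  rw [rhoNeq, h, hc, smul_smul]
  congr 1
  linear_combination c * (-ht) - e * hct

/-! ### The hypothesis testing region -/

/-- A convex combination of complementary projectors is a test. -/
lemma isTest_combination {n d : ℕ} {S : Op n d} (hS : S.IsHermitian) (hSS : S * S = S)
    {a t : ℝ} (ha : a ∈ Set.Icc (0 : ℝ) 1) (ht : t ∈ Set.Icc (0 : ℝ) 1) :
    IsTest ((a : ℂ) • S + (t : ℂ) • (1 - S)) := by
  have hp : S.PosSemidef := by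
    have := Matrix.posSemidef_conjTranspose_mul_self S
    rwa [hS.eq, hSS] at this
  have hq : (1 - S).PosSemidef := by
    have := Matrix.posSemidef_conjTranspose_mul_self (1 - S)
    have h2 : (1 - S)ᴴ * (1 - S) = 1 - S := by
      rw [Matrix.conjTranspose_sub, Matrix.conjTranspose_one, hS.eq, mul_sub, sub_mul, sub_mul,
        hSS]
      simp
    rwa [h2] at this
  have hcomb : ∀ {b s : ℝ}, 0 ≤ b → 0 ≤ s → ((b : ℂ) • S + (s : ℂ) • (1 - S)).PosSemidef :=
    fun hb hs => (hp.smul (by exact_mod_cast hb)).add (hq.smul (by exact_mod_cast hs))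
  refine ⟨hcomb ha.1 ht.1, ?_⟩
  have h := hcomb (sub_nonneg.2 ha.2) (sub_nonneg.2 ht.2)
  convert h using 1
  push_cast
  module

/-- The testing region of `ρ₀` against `ρ₁ = M⁻¹ ρ₀ + R`, where `ρ₀` is a state supported on the
range of the projector `S` and `R = (1 - S) ρ₁ (1 - S)`. -/
lemma mem_region_iff {n d : ℕ} {S ρ₀ ρ₁ : Op n d} {M : ℝ} (hM : 1 ≤ M) (hS : S.IsHermitian)
    (hSS : S * S = S) (hρ₀ : ρ₀.PosSemidef) (ht₀ : ρ₀.trace = 1) (hSρ₀ : S * ρ₀ = ρ₀)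
    (hρ₁ : ρ₁.PosSemidef) (ht₁ : ρ₁.trace = 1) (hcomm : Commute ρ₁ S)
    (hρ₁S : ρ₁ * S = (M : ℂ)⁻¹ • ρ₀) (α β : ℝ) :
    (α, β) ∈ region ρ₀ ρ₁ ↔
      α ∈ Set.Icc (0 : ℝ) 1 ∧ (1 - α) / M ≤ β ∧ β ≤ 1 - α / M := by
  have hM0 : 0 < M := by linarith
  have hMC : ((M : ℂ)⁻¹) = ((M⁻¹ : ℝ) : ℂ) := by push_cast; rfl
  set R := (1 - S) * ρ₁ * (1 - S) with hRdef
  have hR : R.PosSemidef := by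
    have h := hρ₁.mul_mul_conjTranspose_same (1 - S)
    rwa [Matrix.conjTranspose_sub, Matrix.conjTranspose_one, hS.eq] at h
  have hdecomp : ρ₁ = (M : ℂ)⁻¹ • ρ₀ + R := by
    have h1 : S * ρ₁ * S = ρ₁ * S := by rw [← hcomm.eq, mul_assoc, hSS]
    rw [hRdef, mul_sub, mul_one, sub_mul, one_mul, sub_mul, h1, ← hcomm.eq, ← hρ₁S]
    abel
  have hSR : S * R = 0 := by
    rw [hRdef, ← mul_assoc, ← mul_assoc, mul_sub S, mul_one, hSS, sub_self, zero_mul, zero_mul]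
  have htR : R.trace.re = 1 - M⁻¹ := by
    have h := congrArg (fun A : Op n d => A.trace.re) hdecomp
    simp only [Matrix.trace_add, Matrix.trace_smul, ht₀, ht₁, hMC, smul_eq_mul, mul_one,
      Complex.add_re, Complex.one_re, Complex.ofReal_re] at h
    linarith
  have hI : ∀ P : Op n d, typeI ρ₀ P = 1 - (P * ρ₀).trace.re := fun P => rfl
  have hII : ∀ P : Op n d, typeII ρ₁ P = (P * ρ₀).trace.re / M + (P * R).trace.re := by
    intro P
    have h : (P * ρ₁).trace.re = M⁻¹ * (P * ρ₀).trace.re + (P * R).trace.re := by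
      rw [hdecomp, mul_add, Matrix.mul_smul, Matrix.trace_add, Matrix.trace_smul, hMC, smul_eq_mul,
        Complex.add_re, Complex.re_ofReal_mul]
    rw [typeII, soundness, sub_mul, one_mul, Matrix.trace_sub, ht₁, Complex.sub_re,
      Complex.one_re, h]
    ring
  -- the probability of acceptance in a positive operator `ρ` lies between `0` and `Tr ρ`
  have hbound : ∀ {P ρ : Op n d}, IsTest P → ρ.PosSemidef →
      0 ≤ (P * ρ).trace.re ∧ (P * ρ).trace.re ≤ ρ.trace.re := by
    intro P ρ hP hρ
    have h1 := (Complex.le_def.1 (hP.1.trace_mul_nonneg hρ)).1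
    have h2 := (Complex.le_def.1 (hP.2.trace_mul_nonneg hρ)).1
    rw [sub_mul, one_mul, Matrix.trace_sub, Complex.sub_re] at h2
    simp only [Complex.zero_re] at h1 h2
    exact ⟨h1, by linarith⟩
  constructor
  · rintro ⟨P, hP, h1, h2⟩
    rw [hI] at h1
    rw [hII] at h2
    obtain ⟨b1, b2⟩ := hbound hP hρ₀
    obtain ⟨b3, b4⟩ := hbound hP hR
    rw [ht₀, Complex.one_re] at b2
    rw [htR] at b4
    simp only at h1 h2
    have h3 : (P * ρ₀).trace.re = 1 - α := by linarith
    rw [h3] at h2 b1 b2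
    refine ⟨⟨by linarith, by linarith⟩, by linarith, ?_⟩
    rw [← h2, sub_div, one_div]
    linarith
  · rintro ⟨hα, hlo, hhi⟩
    have hα' : 1 - α ∈ Set.Icc (0 : ℝ) 1 := ⟨by linarith [hα.2], by linarith [hα.1]⟩
    -- the part of `β` that the complement of the symmetric subspace has to contribute
    have hgap : ∃ t ∈ Set.Icc (0 : ℝ) 1, t * (1 - M⁻¹) = β - (1 - α) / M := by
      rw [sub_div, one_div] at hlo
      have hinv : M⁻¹ ≤ 1 := inv_le_one_of_one_le₀ hM
      rcases hinv.eq_or_lt with h | h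
      · refine ⟨0, by simp, ?_⟩
        rw [sub_div, one_div]
        linarith
      · have h' : 0 < 1 - M⁻¹ := by linarith
        refine ⟨(β - (1 - α) / M) / (1 - M⁻¹), ⟨?_, ?_⟩, div_mul_cancel₀ _ h'.ne'⟩
        · exact div_nonneg (by rw [sub_div, one_div]; linarith) h'.le
        · rw [div_le_one h', sub_div, one_div]
          linarith
    obtain ⟨t, ht, hteq⟩ := hgap
    have e0 : ((((1 - α : ℝ) : ℂ) • S + (t : ℂ) • (1 - S)) * ρ₀).trace.re = 1 - α := by
      rw [add_mul, Matrix.smul_mul, Matrix.smul_mul, sub_mul, one_mul, hSρ₀, sub_self, smul_zero,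
        add_zero, Matrix.trace_smul, ht₀, smul_eq_mul, mul_one, Complex.ofReal_re]
    have e1 : ((((1 - α : ℝ) : ℂ) • S + (t : ℂ) • (1 - S)) * R).trace.re = t * (1 - M⁻¹) := by
      rw [add_mul, Matrix.smul_mul, Matrix.smul_mul, sub_mul, one_mul, hSR, sub_zero, smul_zero,
        zero_add, Matrix.trace_smul, smul_eq_mul, Complex.re_ofReal_mul, htR]
    refine ⟨_, isTest_combination hS hSS hα' ht, ?_, ?_⟩
    · rw [hI, e0]
      ring
    · rw [hII, e0, e1, hteq]
      ring

lemma mem_region_rhoEq_rhoNeq_iff {n d : ℕ} (hd : 0 < d) (μ : Fin d → ℕ) (hμ : ∑ i, μ i = n)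
    (α β : ℝ) :
    (α, β) ∈ region (rhoEq n hd) (rhoNeq μ hμ) ↔
      α ∈ Set.Icc (0 : ℝ) 1 ∧ (1 - α) / (Nat.multinomial Finset.univ μ : ℝ) ≤ β ∧
        β ≤ 1 - α / (Nat.multinomial Finset.univ μ : ℝ) := by
  refine mem_region_iff (ρ₀ := rhoEq n hd) (ρ₁ := rhoNeq μ hμ) (S := symProj n d)
    (by exact_mod_cast Nat.multinomial_pos Finset.univ μ) (symProj_isHermitian n d)
    (symProj_mul_self n d) (posSemidef_twirl (posSemidef_ketBra _)) ?_ ?_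
    (posSemidef_twirl (posSemidef_ketBra _)) ?_
    (commute_twirl_symProj hd (posSemidef_ketBra _)) ?_ α β
  · rw [rhoEq, trace_twirl, trace_ketBra]
  · obtain ⟨c, hc, -⟩ := rhoEq_eq_smul_symProj n hd
    rw [hc, Matrix.mul_smul, symProj_mul_self]
  · rw [rhoNeq, trace_twirl, trace_ketBra]
  · rw [rhoNeq_mul_symProj hd μ hμ, Complex.ofReal_natCast]

end QSI

theorem proposition4p5 (n d : ℕ) (hd : 1 < d) (μ : Fin d → ℕ) (hanti : Antitone μ)
    (hμ : ∑ i, μ i = n) (hμ₂ : 0 < μ ⟨1, hd⟩) :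
    -- the achievable region is the parallelogram
    QSI.region (QSI.rhoEq n (Nat.zero_lt_of_lt hd)) (QSI.rhoNeq μ hμ) =
      {e : ℝ × ℝ | e.1 ∈ Set.Icc (0 : ℝ) 1 ∧ e.2 ∈ Set.Icc (0 : ℝ) 1 ∧
        (1 - e.1) / (Nat.multinomial Finset.univ μ : ℝ) ≤ e.2 ∧
        e.2 ≤ 1 - e.1 / (Nat.multinomial Finset.univ μ : ℝ)} ∧
    -- its lower and upper boundaries
    (∀ α ∈ Set.Icc (0 : ℝ) 1,
      IsLeast {β : ℝ | (α, β) ∈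
          QSI.region (QSI.rhoEq n (Nat.zero_lt_of_lt hd)) (QSI.rhoNeq μ hμ)}
        ((1 - α) / (Nat.multinomial Finset.univ μ : ℝ)) ∧
      IsGreatest {β : ℝ | (α, β) ∈
          QSI.region (QSI.rhoEq n (Nat.zero_lt_of_lt hd)) (QSI.rhoNeq μ hμ)}
        (1 - α / (Nat.multinomial Finset.univ μ : ℝ))) ∧
    -- the optimal trade-off between completeness and soundness
    (∀ c ∈ Set.Icc (0 : ℝ) 1,
      IsGreatest {s : ℝ | ∃ P : QSI.Op n d, QSI.IsTest P ∧
          QSI.completeness (QSI.rhoEq n (Nat.zero_lt_of_lt hd)) P = c ∧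
          QSI.soundness (QSI.rhoNeq μ hμ) P = s}
        (1 - c / (Nat.multinomial Finset.univ μ : ℝ))) := by
  have hmem := QSI.mem_region_rhoEq_rhoNeq_iff (Nat.zero_lt_of_lt hd) μ hμ
  have hM : (1 : ℝ) ≤ (Nat.multinomial Finset.univ μ : ℝ) := by
    exact_mod_cast Nat.multinomial_pos Finset.univ μ
  set M : ℝ := (Nat.multinomial Finset.univ μ : ℝ)
  have hM0 : 0 < M := by linarith
  -- the two boundary lines do not cross
  have hle : ∀ α : ℝ, (1 - α) / M ≤ 1 - α / M := fun α => by
    rw [sub_div]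
    linarith [(div_le_one hM0).2 hM]
  refine ⟨?_, fun α hα => ⟨⟨?_, ?_⟩, ⟨?_, ?_⟩⟩, fun c hc => ⟨?_, ?_⟩⟩
  · ext ⟨α, β⟩
    rw [hmem]
    refine ⟨fun ⟨hα, h1, h2⟩ => ⟨hα, ⟨?_, ?_⟩, h1, h2⟩, fun ⟨hα, _, h1, h2⟩ => ⟨hα, h1, h2⟩⟩
    · exact (div_nonneg (sub_nonneg.2 hα.2) hM0.le).trans h1
    · exact h2.trans (sub_le_self _ (div_nonneg hα.1 hM0.le))
  · exact (hmem _ _).2 ⟨hα, le_rfl, hle α⟩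
  · exact fun β hβ => ((hmem _ _).1 hβ).2.1
  · exact (hmem _ _).2 ⟨hα, hle α, le_rfl⟩
  · exact fun β hβ => ((hmem _ _).1 hβ).2.2
  · have hα : 1 - c ∈ Set.Icc (0 : ℝ) 1 := ⟨by linarith [hc.2], by linarith [hc.1]⟩
    obtain ⟨P, hP, h1, h2⟩ := (hmem (1 - c) ((1 - (1 - c)) / M)).2 ⟨hα, le_rfl, hle _⟩
    simp only [QSI.typeI, QSI.typeII, sub_sub_cancel] at h1 h2
    exact ⟨P, hP, by linarith, by linarith⟩
  · rintro s ⟨P, hP, h1, rfl⟩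
    have h := ((hmem (1 - c) (QSI.typeII (QSI.rhoNeq μ hμ) P)).1
      ⟨P, hP, by rw [QSI.typeI, h1], rfl⟩).2.1
    rw [QSI.typeII, sub_sub_cancel] at h
    linarith
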